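/- Consider a stochastic bandit with $k\ge 1$ arms whose rewards are Bernoulli with means $1\ge\mu_1>\mu_2>\dots>\mu_k\ge 0$, and let $\Delta_i=\mu_1-\mu_i$. Let $r_i\in[0,1/k)$ for $i\in[k]$ be the fairness quotas and $\alpha\ge 0$ the unfairness tolerance. Write $N_{i,t}$ for the number of pulls of arm $i$ in the first $t$ rounds. In round $t=1,2,\dots$ the algorithm Fair-UCB pulls an arm maximizing $r_i(t-1)-N_{i,t-1}$ if this maximum exceeds $\alpha$; otherwise it follows UCB1, that is, it pulls an arm that has not been pulled yet if there is one, and else an arm maximizing $\hat\mu_i+\sqrt{2\ln t/N_{i,t-1}}$, where $\hat\mu_i$ is the empirical mean of the rewards received from arm $i$ in the first $t-1$ rounds. Ties are broken arbitrarily. Let $\mathcal R(T)=\sum_{i\in[k]}\Delta_i\,\mathbb E[N_{i,T}]$ be the conventional expected regret, and let $$S(T)=\{\,i\in[k],\ i\ne 1 : r_iT-\alpha\ge 8\ln T/\Delta_i^2\,\}.$$ Then, for every $T\ge 1$, $$\mathcal R(T)\le\sum_{i\in S(T)}(r_iT-\alpha)\Delta_i+\sum_{i\notin S(T),\,i\ne1}\frac{8\ln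 T}{\Delta_i}+\Bigl(1+\frac{\pi^2}{3}\Bigr)\sum_{i\in[k]}\Delta_i .$$ Moreover, there is a constant $C$ depending only on $\mu_1,\dots,\mu_k$ such that $\mathcal R(T)\le C\ln T$ whenever $T\ge2$ and $S(T)=\emptyset$, while whenever $S(T)\ne\emptyset$, $$\sum_{i\in S(T)}(r_iT-\alpha-1)\Delta_i\le\mathcal R(T)\le C\,T .$$ -/

import Mathlib

open MeasureTheory ProbabilityTheory

namespace FairMAB

noncomputable section

/-- Number of pulls of arm `i` in the first `n` rounds, when `a m` is the arm pulled in
round `m + 1`. -/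
def pulls {k : ℕ} (a : ℕ → Fin k) (n : ℕ) (i : Fin k) : ℕ :=
  ((Finset.range n).filter (fun m => a m = i)).card

/-- Total reward collected from arm `i` in the first `n` rounds, when `a m` is the arm pulled and
`x m` the reward received in round `m + 1`. -/
def totalReward {k : ℕ} (a : ℕ → Fin k) (x : ℕ → ℝ) (n : ℕ) (i : Fin k) : ℝ :=
  ∑ m ∈ (Finset.range n).filter (fun m => a m = i), x m

/-- A learning rule: from the number `n` of completed rounds, the pull counts and the total rewards
of the arms, the set of arms that it may pull next (more than one arm only because of ties). -/
abbrev LearningRule (k : ℕ) : Type := ℕ → (Fin k → ℕ) → (Fin k → ℝ) → Set (Fin k)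

/-- The UCB1 index, in round `n + 1`, of an arm that has been pulled `N ≥ 1` times in the first
`n` rounds with total reward `S`. -/
def ucbIndex (n N : ℕ) (S : ℝ) : ℝ :=
  S / N + Real.sqrt (2 * Real.log ((n : ℝ) + 1) / N)

/-- UCB1: an arm that has not been pulled yet, as long as there is one; otherwise an arm with the
highest index. -/
def ucb1 (k : ℕ) : LearningRule k := fun n N S =>
  {i | (∃ j, N j = 0) ∧ N i = 0} ∪
    {i | (∀ j, N j ≠ 0) ∧ ∀ j, ucbIndex n (N j) (S j) ≤ ucbIndex n (N i) (S i)}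

/-- The set `A` of arms that, after `n` rounds, lag behind their quota by more than `α`. -/
def laggingArms {k : ℕ} (r : Fin k → ℝ) (α : ℝ) (n : ℕ) (N : Fin k → ℕ) : Set (Fin k) :=
  {i | α < r i * n - N i}

/-- The meta-algorithm Fair-Learn: if some arm lags behind by more than `α`, pull an arm that lags
behind the most; otherwise follow the learning rule. -/
def fairLearn {k : ℕ} (r : Fin k → ℝ) (α : ℝ) (learn : LearningRule k) : LearningRule k :=
  fun n N S =>
    {i | (laggingArms r α n N).Nonempty ∧ ∀ j, r j * n - N j ≤ r i * n - N i} ∪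
      {i | ¬ (laggingArms r α n N).Nonempty ∧ i ∈ learn n N S}

/-- Fair-UCB is Fair-Learn with UCB1 as the learning rule. -/
def fairUCB {k : ℕ} (r : Fin k → ℝ) (α : ℝ) : LearningRule k := fairLearn r α (ucb1 k)

/-- A run of the (possibly tie-breaking) algorithm `alg` on the Bernoulli bandit with means `μ`.
In round `n + 1` the arm `a n` is pulled and the reward `x n` is received; `ℱ n` is the information
available after `n` rounds (it may include randomness used to break ties).
The arm is chosen from `ℱ n` according to `alg`, and, given `ℱ n`, the reward is
Bernoulli with mean `μ (a n)`. -/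
structure IsRun {k : ℕ} {Ω : Type*} [mΩ : MeasurableSpace Ω] (P : Measure Ω)
    (ℱ : Filtration ℕ mΩ) (alg : LearningRule k) (μ : Fin k → ℝ)
    (a : ℕ → Ω → Fin k) (x : ℕ → Ω → ℝ) : Prop where
  arm_measurable : ∀ n, Measurable[ℱ n] (a n)
  reward_measurable : ∀ n, Measurable[ℱ (n + 1)] (x n)
  arm_mem : ∀ n ω, a n ω ∈
    alg n (pulls (fun m => a m ω) n) (totalReward (fun m => a m ω) (fun m => x m ω) n)
  reward_binary : ∀ n, ∀ᵐ ω ∂P, x n ω = 0 ∨ x n ω = 1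
  reward_mean : ∀ n, P[x n | ℱ n] =ᵐ[P] fun ω => μ (a n ω)

/-- The gap of arm `i`; the arm `0` is the optimal one (the means are strictly decreasing). -/
def gap {k : ℕ} [NeZero k] (μ : Fin k → ℝ) (i : Fin k) : ℝ := μ 0 - μ i

/-- The conventional expected regret after `T` rounds. -/
def expectedRegret {k : ℕ} [NeZero k] {Ω : Type*} [MeasurableSpace Ω] (P : Measure Ω)
    (μ : Fin k → ℝ) (a : ℕ → Ω → Fin k) (T : ℕ) : ℝ :=
  ∑ i, gap μ i * ∫ ω, (pulls (fun m => a m ω) T i : ℝ) ∂P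

open Classical in
/-- The set `S(T)` of suboptimal arms whose quota, less the tolerance, is at least
`8 ln T / Δ_i ^ 2`. (The optimal arm, whose gap is zero, never belongs to it.) -/
def costlyArms {k : ℕ} [NeZero k] (μ r : Fin k → ℝ) (α : ℝ) (T : ℕ) : Finset (Fin k) :=
  Finset.univ.filter (fun i => i ≠ 0 ∧ 8 * Real.log T / gap μ i ^ 2 ≤ r i * T - α)

end

end FairMAB

/-! The upper bound compares each suboptimal arm's pull count with `u`, the larger of `8 ln T / Δ_i
^ 2` and `r_i T - α`. Once `N_i ≥ u`, the arm is within its quota, so a further pull must come from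
UCB1. Its confidence radius is then at most `Δ_i / 2`, so UCB1 can prefer it to the optimal arm only
if one of the two empirical means is off by its radius (`IsRun.late_pull_subset`). Rewards are only
conditionally Bernoulli given an adaptive choice of arm, so this is controlled by an exponential
supermartingale and Markov's inequality (`integral_expSupermart_le`). A union bound over pull counts
leaves `2 / t ^ 2` for round `t`, with total at most `π ^ 2 / 3`; rounding `u` up costs the
remaining `1`.

The lower bound is pathwise: `quota_sub_pulls_le` gives `N_i ≥ r_i T - α - 1`. It follows from a
staircase of invariants on how many arms exceed each level `α + j / k` (`card_lagging_le`). -/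

namespace FairMAB

/-! ### Pull counts and reward totals along one path -/

section Counting

variable {k : ℕ} (a : ℕ → Fin k) (x : ℕ → ℝ) (n : ℕ) (i : Fin k)

lemma pulls_zero : pulls a 0 i = 0 := by simp [pulls]

lemma pulls_succ : pulls a (n + 1) i = pulls a n i + if a n = i then 1 else 0 := by
  unfold pulls
  rw [Finset.range_add_one, Finset.filter_insert]
  split_ifs with h
  · rw [Finset.card_insert_of_notMem (by simp)]
  · rfl

lemma totalReward_succ :
    totalReward a x (n + 1) i = totalReward a x n i + if a n = i then x n else 0 := by
  simp only [totalReward, Finset.sum_filter, Finset.sum_range_succ]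

lemma pulls_le : pulls a n i ≤ n := by
  simpa [pulls] using Finset.card_filter_le (Finset.range n) (fun m => a m = i)

/-- The number of pulls is at most `l` plus the number of rounds in which the arm is pulled
although it has been pulled `l` times already. -/
lemma pulls_le_add_sum (l : ℕ) :
    pulls a n i ≤ l + ∑ m ∈ Finset.range n, if a m = i ∧ l ≤ pulls a m i then 1 else 0 := by
  induction n with
  | zero => simp [pulls_zero]
  | succ n ih =>
    rw [pulls_succ, Finset.sum_range_succ]
    by_cases h : a n = i <;> by_cases h' : l ≤ pulls a n i <;>
      simp only [h, h', if_true, if_false, and_self, and_false, false_and] <;> omega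

end Counting

/-! ### Pathwise fairness guarantee -/

section Fairness

/-- At any time at most `k - j` arms lag behind by more than `α + j / k`. -/
lemma card_lagging_le {k : ℕ} {r : Fin k → ℝ} {α : ℝ} (hr : ∀ i, 0 ≤ r i ∧ r i < 1 / (k : ℝ))
    (hα : 0 ≤ α) {learn : LearningRule k} {a : ℕ → Fin k} {x : ℕ → ℝ}
    (ha : ∀ n, a n ∈ fairLearn r α learn n (pulls a n) (totalReward a x n)) (n : ℕ) :
    ∀ j ≤ k, (Finset.univ.filter
      (fun i : Fin k => α + (j : ℝ) / k < r i * n - pulls a n i)).card + j ≤ k := by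
  induction n with
  | zero =>
    intro j hj
    rw [Finset.filter_false_of_mem]
    · simpa using hj
    · intro i _
      have : (0 : ℝ) ≤ (j : ℝ) / k := by positivity
      simp only [pulls_zero, Nat.cast_zero, mul_zero, sub_zero, not_lt]
      linarith
  | succ n ih =>
    intro j hj
    rcases Nat.eq_zero_or_pos k with rfl | hk
    · exact (a 0).elim0
    have hk' : (0 : ℝ) < k := by exact_mod_cast hk
    rcases Nat.eq_zero_or_pos j with rfl | hj0
    · simpa using Finset.card_filter_le (Finset.univ : Finset (Fin k)) _
    obtain ⟨j, rfl⟩ : ∃ j', j = j' + 1 := ⟨j - 1, by omega⟩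
    -- Two levels of the induction hypothesis are used: level `j` bounds the set of candidates, and
    -- level `k` says that no deficit exceeds `α + 1`.
    have ihj := ih j (by omega)
    have ihk := ih k le_rfl
    rw [div_self hk'.ne'] at ihk
    have hle : ∀ i, r i * n - pulls a n i ≤ α + 1 := by
      intro i
      by_contra! h
      have : 0 < (Finset.univ.filter
          (fun i : Fin k => α + 1 < r i * n - pulls a n i)).card :=
        Finset.card_pos.mpr ⟨i, by simpa using h⟩
      omega
    have hj1 : ((j + 1 : ℕ) : ℝ) / k = (j : ℝ) / k + 1 / k := by push_cast; ring
    have hjk : (0 : ℝ) ≤ (j : ℝ) / k := by positivity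
    set A := Finset.univ.filter (fun i : Fin k => α + (j : ℝ) / k < r i * n - pulls a n i)
    -- A deficit grows by `r i < 1 / k` per round, so an arm above level `j + 1` was above level
    -- `j`. The pulled arm drops from at most `α + 1` to below `α + 1 / k`, hence leaves.
    have hsub : Finset.univ.filter (fun i : Fin k =>
        α + ((j + 1 : ℕ) : ℝ) / k < r i * (n + 1 : ℕ) - pulls a (n + 1) i) ⊆ A.erase (a n) := by
      intro i hi
      simp only [Finset.mem_filter, Finset.mem_univ, true_and] at hi
      rw [pulls_succ, hj1] at hi
      push_cast at hi
      have h1 := (hr i).2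
      rw [Finset.mem_erase]
      by_cases hai : a n = i
      · rw [if_pos hai] at hi
        have := hle i
        linarith
      · rw [if_neg hai] at hi
        refine ⟨fun h => hai h.symm, ?_⟩
        simp only [A, Finset.mem_filter, Finset.mem_univ, true_and]
        linarith
    have hcard := Finset.card_le_card hsub
    rcases A.eq_empty_or_nonempty with hA | ⟨i, hi⟩
    · rw [hA] at hcard
      simp only [Finset.erase_empty, Finset.card_empty] at hcard
      omega
    · simp only [A, Finset.mem_filter, Finset.mem_univ, true_and] at hi
      have hlag : (laggingArms r α n (pulls a n)).Nonempty :=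
        ⟨i, show α < r i * n - pulls a n i by linarith⟩
      -- A nonempty `A` forces the quota branch, whose maximal arm lies in `A`; erasing it lowers
      -- the count by one.
      have hmem : a n ∈ A := by
        rcases ha n with h | h
        · simp only [A, Finset.mem_filter, Finset.mem_univ, true_and]
          exact hi.trans_le (h.2 i)
        · exact absurd hlag h.1
      rw [Finset.card_erase_of_mem hmem] at hcard
      have : 0 < A.card := Finset.card_pos.mpr ⟨_, hmem⟩
      omega

/-- Fair-Learn never lets an arm lag behind by more than `α + 1`. -/
lemma quota_sub_pulls_le {k : ℕ} {r : Fin k → ℝ} {α : ℝ}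
    (hr : ∀ i, 0 ≤ r i ∧ r i < 1 / (k : ℝ)) (hα : 0 ≤ α) {learn : LearningRule k}
    {a : ℕ → Fin k} {x : ℕ → ℝ}
    (ha : ∀ n, a n ∈ fairLearn r α learn n (pulls a n) (totalReward a x n)) (n : ℕ) (i : Fin k) :
    r i * n - pulls a n i ≤ α + 1 := by
  have h := card_lagging_le hr hα ha n k le_rfl
  have hk : (k : ℝ) ≠ 0 := by
    rintro h0
    have : k = 0 := by exact_mod_cast h0
    subst this
    exact i.elim0
  rw [div_self hk] at h
  by_contra! hi
  have : 0 < (Finset.univ.filter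
      (fun i : Fin k => α + 1 < r i * n - pulls a n i)).card :=
    Finset.card_pos.mpr ⟨i, by simpa using hi⟩
  omega

end Fairness

/-! ### Concentration under adaptive sampling -/

section Concentration

/-- Hoeffding's lemma for a Bernoulli variable. -/
lemma one_add_mul_exp_sub_one_le {p : ℝ} (hp : p ∈ Set.Icc (0 : ℝ) 1) (t : ℝ) :
    1 + p * (Real.exp t - 1) ≤ Real.exp (t * p + t ^ 2 / 8) := by
  let ν : Measure ℝ :=
    ENNReal.ofReal p • Measure.dirac 1 + ENNReal.ofReal (1 - p) • Measure.dirac 0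
  have hν : IsProbabilityMeasure ν := by
    constructor
    simp only [ν, Measure.add_apply, Measure.smul_apply, measure_univ, smul_eq_mul, mul_one]
    rw [← ENNReal.ofReal_add hp.1 (by linarith [hp.2])]
    simp
  have hint : ∀ f : ℝ → ℝ, ∫ y, f y ∂ν = p * f 1 + (1 - p) * f 0 := by
    intro f
    rw [integral_add_measure, integral_smul_measure, integral_smul_measure, integral_dirac,
      integral_dirac, ENNReal.toReal_ofReal hp.1, ENNReal.toReal_ofReal (by linarith [hp.2])]
    · simp
    · exact (integrable_dirac (by simp)).smul_measure (by simp)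
    · exact (integrable_dirac (by simp)).smul_measure (by simp)
  have hb : ∀ᵐ y ∂ν, id y ∈ Set.Icc (0 : ℝ) 1 := by
    simp only [ν, ae_add_measure_iff]
    refine ⟨Measure.ae_smul_measure ?_ _, Measure.ae_smul_measure ?_ _⟩
    · simp [ae_dirac_eq]
    · simp [ae_dirac_eq]
  -- A variable in an interval of length 1 is sub-Gaussian with variance proxy `1 / 4`, whence `t ^
  -- 2 / 8`.
  have h := (hasSubgaussianMGF_of_mem_Icc (μ := ν) (X := id) aemeasurable_id hb).mgf_le t
  simp only [mgf, hint, id] at h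
  norm_num at h
  have h2 : 1 + p * (Real.exp t - 1) =
      Real.exp (t * p) * (p * Real.exp (t * (1 - p)) + (1 - p) * Real.exp (-(t * p))) := by
    have e1 : Real.exp (t * (1 - p)) = Real.exp t * Real.exp (-(t * p)) := by
      rw [← Real.exp_add]; ring_nf
    have e2 : Real.exp (t * p) * Real.exp (-(t * p)) = 1 := by
      rw [← Real.exp_add]; simp
    rw [e1]
    linear_combination (-(p * Real.exp t + (1 - p))) * e2
  rw [h2, Real.exp_add]
  refine mul_le_mul_of_nonneg_left (h.trans (Real.exp_le_exp.mpr ?_)) (Real.exp_pos _).le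
  ring_nf
  rfl

variable {k : ℕ} {Ω : Type*} [mΩ : MeasurableSpace Ω] {P : Measure Ω} {ℱ : Filtration ℕ mΩ}
  {alg : LearningRule k} {μ : Fin k → ℝ} {a : ℕ → Ω → Fin k} {x : ℕ → Ω → ℝ}

namespace IsRun

lemma measurableSet_arm_eq (h : IsRun P ℱ alg μ a x) (n : ℕ) (i : Fin k) :
    MeasurableSet[ℱ n] {ω | a n ω = i} :=
  h.arm_measurable n (measurableSet_singleton i)

lemma measurable_pulls (h : IsRun P ℱ alg μ a x) (n : ℕ) (i : Fin k) :
    Measurable[ℱ n] fun ω => (pulls (fun m => a m ω) n i : ℝ) := by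
  induction n with
  | zero => simp [pulls_zero]
  | succ n ih =>
    simp only [pulls_succ, Nat.cast_add, Nat.cast_ite, Nat.cast_one, Nat.cast_zero]
    exact (ih.mono (ℱ.mono n.le_succ) le_rfl).add
      (Measurable.ite (ℱ.mono n.le_succ _ (h.measurableSet_arm_eq n i))
        measurable_const measurable_const)

lemma measurable_totalReward (h : IsRun P ℱ alg μ a x) (n : ℕ) (i : Fin k) :
    Measurable[ℱ n] fun ω => totalReward (fun m => a m ω) (fun m => x m ω) n i := by
  induction n with
  | zero => simp [totalReward]
  | succ n ih =>
    simp only [totalReward_succ]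
    exact (ih.mono (ℱ.mono n.le_succ) le_rfl).add
      (Measurable.ite (ℱ.mono n.le_succ _ (h.measurableSet_arm_eq n i))
        (h.reward_measurable n) measurable_const)

lemma integrable_pulls [IsProbabilityMeasure P] (h : IsRun P ℱ alg μ a x) (n : ℕ) (i : Fin k) :
    Integrable (fun ω => (pulls (fun m => a m ω) n i : ℝ)) P :=
  Integrable.of_bound ((h.measurable_pulls n i).mono (ℱ.le n) le_rfl).aestronglyMeasurable n
    (ae_of_all _ fun ω => by
      rw [Real.norm_natCast]
      exact_mod_cast pulls_le _ n i)

end IsRun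

/-- The exponential supermartingale of the centred rewards of arm `i`. -/
noncomputable def expSupermart (μ : Fin k → ℝ) (a : ℕ → Ω → Fin k) (x : ℕ → Ω → ℝ) (i : Fin k)
    (t : ℝ) (n : ℕ) (ω : Ω) : ℝ :=
  Real.exp (t * (totalReward (fun m => a m ω) (fun m => x m ω) n i -
    μ i * pulls (fun m => a m ω) n i) - t ^ 2 / 8 * pulls (fun m => a m ω) n i)

namespace IsRun

lemma measurable_expSupermart (h : IsRun P ℱ alg μ a x) (i : Fin k) (t : ℝ) (n : ℕ) :
    Measurable[ℱ n] (expSupermart μ a x i t n) :=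
  Real.measurable_exp.comp ((((h.measurable_totalReward n i).sub
    ((h.measurable_pulls n i).const_mul _)).const_mul _).sub
    ((h.measurable_pulls n i).const_mul _))

lemma integral_expSupermart_le [IsProbabilityMeasure P] (h : IsRun P ℱ alg μ a x) (i : Fin k)
    (hμ : μ i ∈ Set.Icc (0 : ℝ) 1) (t : ℝ) (n : ℕ) :
    Integrable (expSupermart μ a x i t n) P ∧ ∫ ω, expSupermart μ a x i t n ω ∂P ≤ 1 := by
  induction n with
  | zero =>
    have : expSupermart μ a x i t 0 = fun _ => 1 := by
      ext ω; simp [expSupermart, pulls_zero, totalReward]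
    rw [this]
    simp
  | succ n ih =>
    obtain ⟨hint, hle⟩ := ih
    set Z := expSupermart μ a x i t n with hZ
    have hZm : Measurable[ℱ n] Z := h.measurable_expSupermart i t n
    have hZ0 : ∀ ω, 0 ≤ Z ω := fun ω => (Real.exp_pos _).le
    set c := Real.exp (-(t * μ i) - t ^ 2 / 8) with hc
    set A : Ω → ℝ := fun ω => if a n ω = i then c else 1 with hA
    set B : Ω → ℝ := fun ω => if a n ω = i then c * (Real.exp t - 1) else 0 with hB
    have hAm : Measurable[ℱ n] A :=
      Measurable.ite (h.measurableSet_arm_eq n i) measurable_const measurable_const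
    have hBm : Measurable[ℱ n] B :=
      Measurable.ite (h.measurableSet_arm_eq n i) measurable_const measurable_const
    have hxm : Measurable (x n) := (h.reward_measurable n).mono (ℱ.le _) le_rfl
    have hxb : ∀ᵐ ω ∂P, ‖x n ω‖ ≤ 1 := by
      filter_upwards [h.reward_binary n] with ω hω
      rcases hω with hω | hω <;> simp [hω]
    have hxint : Integrable (x n) P := Integrable.of_bound hxm.aestronglyMeasurable 1 hxb
    have hZA : Integrable (fun ω => Z ω * A ω) P := by
      refine hint.mul_bdd (c := max |c| 1) (hAm.mono (ℱ.le n) le_rfl).aestronglyMeasurable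
        (ae_of_all _ fun ω => ?_)
      simp only [hA]
      split_ifs <;> simp
    have hZB : Integrable (fun ω => Z ω * B ω) P := by
      refine hint.mul_bdd (c := |c * (Real.exp t - 1)|)
        (hBm.mono (ℱ.le n) le_rfl).aestronglyMeasurable (ae_of_all _ fun ω => ?_)
      simp only [hB]
      split_ifs
      · simp
      · simpa using mul_nonneg (abs_nonneg _) (abs_nonneg _)
    have hZBm : StronglyMeasurable[ℱ n] (fun ω => Z ω * B ω) := (hZm.mul hBm).stronglyMeasurable
    have hZBx : Integrable (fun ω => Z ω * B ω * x n ω) P :=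
      hZB.mul_bdd hxm.aestronglyMeasurable hxb
    -- For `x ∈ {0, 1}`, `exp (t x) = 1 + (exp t - 1) x`. The new factor is affine in the reward, so
    -- its conditional mean suffices.
    have hstep : expSupermart μ a x i t (n + 1) =ᵐ[P]
        fun ω => Z ω * A ω + Z ω * B ω * x n ω := by
      filter_upwards [h.reward_binary n] with ω hω
      simp only [hA, hB, hZ, expSupermart, pulls_succ, totalReward_succ]
      by_cases hi : a n ω = i
      · simp only [hi, if_true, hc]
        rcases hω with hω | hω
        · rw [hω, mul_zero, add_zero, ← Real.exp_add]
          push_cast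
          ring_nf
        · rw [hω, mul_one, ← mul_add,
            show ∀ u v : ℝ, u + u * (v - 1) = u * v by intros; ring, ← Real.exp_add,
            ← Real.exp_add]
          push_cast
          ring_nf
      · simp [hi]
    have hcond : ∫ ω, Z ω * B ω * x n ω ∂P = ∫ ω, Z ω * B ω * μ (a n ω) ∂P := by
      rw [← integral_condExp (ℱ.le n)]
      refine integral_congr_ae ?_
      have h1 := condExp_mul_of_stronglyMeasurable_left (m := ℱ n) (μ := P) hZBm hZBx hxint
      filter_upwards [h1, h.reward_mean n] with ω h1 h2
      exact h1.trans (by simp only [Pi.mul_apply]; rw [h2])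
    have hBμ : ∀ ω, Z ω * B ω * μ (a n ω) = Z ω * B ω * μ i := by
      intro ω
      by_cases hi : a n ω = i
      · rw [hi]
      · simp [hB, hi]
    refine ⟨(hZA.add hZBx).congr hstep.symm, ?_⟩
    rw [integral_congr_ae hstep, integral_add hZA hZBx, hcond]
    simp only [hBμ]
    rw [← integral_add hZA (hZB.mul_const _)]
    refine (integral_mono (hZA.add (hZB.mul_const _)) hint fun ω => ?_).trans hle
    have key : A ω + B ω * μ i ≤ 1 := by
      by_cases hi : a n ω = i
      · simp only [hA, hB, hi, if_true]
        have h1 := one_add_mul_exp_sub_one_le hμ t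
        have h2 : c * Real.exp (t * μ i + t ^ 2 / 8) = 1 := by
          rw [hc, ← Real.exp_add]; ring_nf; simp
        calc c + c * (Real.exp t - 1) * μ i = c * (1 + μ i * (Real.exp t - 1)) := by ring
          _ ≤ c * Real.exp (t * μ i + t ^ 2 / 8) :=
            mul_le_mul_of_nonneg_left h1 (Real.exp_pos _).le
          _ = 1 := h2
      · simp [hA, hB, hi]
    calc Z ω * A ω + Z ω * B ω * μ i = Z ω * (A ω + B ω * μ i) := by ring
      _ ≤ Z ω * 1 := mul_le_mul_of_nonneg_left key (hZ0 ω)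
      _ = Z ω := mul_one _

/-- Chernoff bound for the rewards of an arm that has been pulled `s` times. -/
lemma measureReal_deviation_le [IsProbabilityMeasure P] (h : IsRun P ℱ alg μ a x) (i : Fin k)
    (hμ : μ i ∈ Set.Icc (0 : ℝ) 1) (t v : ℝ) (n s : ℕ) :
    P.real {ω | pulls (fun m => a m ω) n i = s ∧
      v ≤ t * (totalReward (fun m => a m ω) (fun m => x m ω) n i - μ i * s)} ≤
      Real.exp (t ^ 2 / 8 * s - v) := by
  obtain ⟨hint, hle⟩ := h.integral_expSupermart_le i hμ t n
  have hm := mul_meas_ge_le_integral_of_nonneg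
    (ae_of_all P fun ω => (Real.exp_pos _).le : 0 ≤ᵐ[P] expSupermart μ a x i t n) hint
    (Real.exp (v - t ^ 2 / 8 * s))
  have hsub : {ω | pulls (fun m => a m ω) n i = s ∧
      v ≤ t * (totalReward (fun m => a m ω) (fun m => x m ω) n i - μ i * s)} ⊆
      {ω | Real.exp (v - t ^ 2 / 8 * s) ≤ expSupermart μ a x i t n ω} := by
    rintro ω ⟨h1, h2⟩
    simp only [Set.mem_ofPred_eq, expSupermart, h1]
    exact Real.exp_le_exp.mpr (by linarith)
  have h1 := (mul_le_mul_of_nonneg_left (measureReal_mono (μ := P) hsub)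
    (Real.exp_pos (v - t ^ 2 / 8 * s)).le).trans (hm.trans hle)
  have h2 : Real.exp (t ^ 2 / 8 * s - v) * Real.exp (v - t ^ 2 / 8 * s) = 1 := by
    rw [← Real.exp_add]; simp
  have h3 := mul_le_mul_of_nonneg_left h1 (Real.exp_pos (t ^ 2 / 8 * s - v)).le
  rwa [← mul_assoc, h2, one_mul, mul_one] at h3

end IsRun

/-- The runs in which, after `n` rounds, arm `i` has been pulled `s` times and its empirical mean,
in the direction given by the sign `ε`, is off by at least the confidence radius of UCB1. -/
def deviationSet (μ : Fin k → ℝ) (a : ℕ → Ω → Fin k) (x : ℕ → Ω → ℝ) (i : Fin k) (ε : ℝ)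
    (n s : ℕ) : Set Ω :=
  {ω | pulls (fun m => a m ω) n i = s ∧ s * Real.sqrt (2 * Real.log ((n : ℝ) + 1) / s) ≤
    ε * (totalReward (fun m => a m ω) (fun m => x m ω) n i - μ i * s)}

lemma IsRun.measureReal_deviationSet_le [IsProbabilityMeasure P] (h : IsRun P ℱ alg μ a x)
    (i : Fin k) (hμ : μ i ∈ Set.Icc (0 : ℝ) 1) {ε : ℝ} (hε : ε ^ 2 = 1) (n : ℕ) {s : ℕ}
    (hs : s ≠ 0) : P.real (deviationSet μ a x i ε n s) ≤ 1 / ((n : ℝ) + 1) ^ 4 := by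
  have hs' : (0 : ℝ) < s := by positivity
  have hlog : 0 ≤ Real.log ((n : ℝ) + 1) := Real.log_nonneg (by linarith [n.cast_nonneg (α := ℝ)])
  set c := Real.sqrt (2 * Real.log ((n : ℝ) + 1) / s)
  have hc0 : 0 ≤ c := Real.sqrt_nonneg _
  have hc : s * c ^ 2 = 2 * Real.log ((n : ℝ) + 1) := by
    rw [Real.sq_sqrt (by positivity)]
    field_simp
  -- The slope `4 c` minimizes `t ^ 2 / 8 * s - t * s * c`; the exponent becomes `-2 s c ^ 2 = -4 ln
  -- (n + 1)`.
  have hb := h.measureReal_deviation_le i hμ (4 * c * ε) (4 * c * (s * c)) n s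
  have hexp : Real.exp ((4 * c * ε) ^ 2 / 8 * s - 4 * c * (s * c)) = 1 / ((n : ℝ) + 1) ^ 4 := by
    have : (4 * c * ε) ^ 2 / 8 * s - 4 * c * (s * c) = -(4 * Real.log ((n : ℝ) + 1)) := by
      linear_combination (2 * c ^ 2 * s) * hε - 2 * hc
    have hpow : 4 * Real.log ((n : ℝ) + 1) = Real.log (((n : ℝ) + 1) ^ 4) := by
      rw [Real.log_pow]; norm_num
    rw [this, Real.exp_neg, one_div, hpow, Real.exp_log (by positivity)]
  rw [hexp] at hb
  refine (measureReal_mono ?_).trans hb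
  rintro ω ⟨h1, h2⟩
  refine ⟨h1, ?_⟩
  have := mul_le_mul_of_nonneg_left h2 (by positivity : 0 ≤ 4 * c)
  linarith

end Concentration

/-! ### UCB1 analysis and regret bounds -/

section Regret

/-- UCB1 prefers a suboptimal arm that has been pulled often only if one of the two empirical means
is off by at least the confidence radius. -/
lemma deviation_of_ucbIndex_le {m₀ m₁ S₀ S₁ L : ℝ} {n s₀ s₁ : ℕ} (hs₀ : s₀ ≠ 0) (hs₁ : s₁ ≠ 0)
    (hm : m₁ < m₀) (hL : Real.log ((n : ℝ) + 1) ≤ L) (hs : 8 * L / (m₀ - m₁) ^ 2 ≤ s₁)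
    (hidx : ucbIndex n s₀ S₀ ≤ ucbIndex n s₁ S₁) :
    s₀ * Real.sqrt (2 * Real.log ((n : ℝ) + 1) / s₀) ≤ -1 * (S₀ - m₀ * s₀) ∨
      s₁ * Real.sqrt (2 * Real.log ((n : ℝ) + 1) / s₁) ≤ 1 * (S₁ - m₁ * s₁) := by
  by_contra! hcon
  obtain ⟨h0, h1⟩ := hcon
  have p0 : (0 : ℝ) < s₀ := by positivity
  have p1 : (0 : ℝ) < s₁ := by positivity
  unfold ucbIndex at hidx
  set c₀ := Real.sqrt (2 * Real.log ((n : ℝ) + 1) / s₀)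
  set c₁ := Real.sqrt (2 * Real.log ((n : ℝ) + 1) / s₁) with hc₁
  have hd : 0 < m₀ - m₁ := by linarith
  have hc : c₁ ≤ (m₀ - m₁) / 2 := by
    rw [hc₁]
    refine Real.sqrt_le_iff.mpr ⟨by linarith, ?_⟩
    rw [div_le_iff₀ (by positivity)] at hs
    rw [div_le_iff₀ p1]
    nlinarith
  have e0 : m₀ - c₀ < S₀ / s₀ := by rw [lt_div_iff₀ p0]; linarith
  have e1 : S₁ / s₁ < m₁ + c₁ := by rw [div_lt_iff₀ p1]; linarith
  -- The chain is `m₀ < S₀ / s₀ + c₀ ≤ S₁ / s₁ + c₁ < m₁ + 2 c₁ ≤ m₀`.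
  linarith

lemma sum_two_div_sq_le (T : ℕ) :
    ∑ n ∈ Finset.range T, 2 / ((n : ℝ) + 1) ^ 2 ≤ Real.pi ^ 2 / 3 := by
  have h := (hasSum_nat_add_iff' (f := fun n : ℕ => 1 / (n : ℝ) ^ 2) 1).mpr hasSum_zeta_two
  simp only [Finset.range_one, Finset.sum_singleton, Nat.cast_zero, ne_eq, OfNat.ofNat_ne_zero,
    not_false_eq_true, zero_pow, div_zero, sub_zero] at h
  have h2 := sum_le_hasSum (Finset.range T) (fun n _ => by positivity) h
  have : ∑ n ∈ Finset.range T, 2 / ((n : ℝ) + 1) ^ 2 =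
      2 * ∑ n ∈ Finset.range T, 1 / ((n + 1 : ℕ) : ℝ) ^ 2 := by
    rw [Finset.mul_sum]
    exact Finset.sum_congr rfl fun n _ => by push_cast; ring
  rw [this]
  linarith

variable {k : ℕ} [NeZero k] {Ω : Type*} [mΩ : MeasurableSpace Ω] {P : Measure Ω}
  {ℱ : Filtration ℕ mΩ} {μ r : Fin k → ℝ} {α : ℝ} {a : ℕ → Ω → Fin k} {x : ℕ → Ω → ℝ}

lemma gap_pos (hμ : StrictAnti μ) {i : Fin k} (hi : i ≠ 0) : 0 < gap μ i :=
  sub_pos.mpr (hμ (Fin.pos_iff_ne_zero.mpr hi))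

lemma gap_nonneg (hμ : StrictAnti μ) (i : Fin k) : 0 ≤ gap μ i :=
  sub_nonneg.mpr (hμ.antitone (Fin.zero_le i))

/-- A pull of an arm that has been pulled more often than its quota demands and than the UCB1
analysis allows is a deviation event. -/
lemma IsRun.late_pull_subset (h : IsRun P ℱ (fairUCB r α) μ a x) (hμ : StrictAnti μ)
    (hr : ∀ i, 0 ≤ r i) {i : Fin k} (hi : i ≠ 0) {T n l : ℕ} (hn : n < T) (hl0 : l ≠ 0)
    (hl : 8 * Real.log T / gap μ i ^ 2 ≤ l) (hlr : r i * T - α ≤ l) :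
    {ω | a n ω = i ∧ l ≤ pulls (fun m => a m ω) n i} ⊆
      ⋃ s ∈ Finset.Icc 1 n, (deviationSet μ a x 0 (-1) n s ∪ deviationSet μ a x i 1 n s) := by
  rintro ω ⟨hai, hlN⟩
  have hlN' : (l : ℝ) ≤ pulls (fun m => a m ω) n i := by exact_mod_cast hlN
  have hnT : (n : ℝ) + 1 ≤ T := by exact_mod_cast hn
  rcases h.arm_mem n ω with ⟨⟨j, hj⟩, hmax⟩ | ⟨-, hucb⟩
  -- In the quota branch the pulled arm has the largest deficit, which exceeds `α`; but `l ≥ r i * T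
  -- - α` keeps the deficit of `i` at most `α`.
  · exfalso
    rw [hai] at hmax
    have h1 : α < r i * n - pulls (fun m => a m ω) n i := lt_of_lt_of_le hj (hmax j)
    have h2 : r i * n ≤ r i * T := mul_le_mul_of_nonneg_left (by linarith) (hr i)
    linarith
  · rw [hai] at hucb
    rcases hucb with ⟨-, h0⟩ | ⟨hne, hmax⟩
    · omega
    · have hlog : Real.log ((n : ℝ) + 1) ≤ Real.log T := Real.log_le_log (by positivity) hnT
      rcases deviation_of_ucbIndex_le (hne 0) (hne i) (hμ (Fin.pos_iff_ne_zero.mpr hi)) hlog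
        (hl.trans hlN') (hmax 0) with hd | hd
      · refine Set.mem_biUnion (Finset.mem_coe.mpr (Finset.mem_Icc.mpr
          ⟨Nat.one_le_iff_ne_zero.mpr (hne 0), pulls_le _ n 0⟩)) (Or.inl ⟨rfl, hd⟩)
      · refine Set.mem_biUnion (Finset.mem_coe.mpr (Finset.mem_Icc.mpr
          ⟨Nat.one_le_iff_ne_zero.mpr (hne i), pulls_le _ n i⟩)) (Or.inr ⟨rfl, hd⟩)

lemma IsRun.measureReal_late_pull_le [IsProbabilityMeasure P]
    (h : IsRun P ℱ (fairUCB r α) μ a x) (hμ : StrictAnti μ)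
    (hμ_mem : ∀ i, μ i ∈ Set.Icc (0 : ℝ) 1)
    (hr : ∀ i, 0 ≤ r i) {i : Fin k} (hi : i ≠ 0) {T n l : ℕ} (hn : n < T) (hl0 : l ≠ 0)
    (hl : 8 * Real.log T / gap μ i ^ 2 ≤ l) (hlr : r i * T - α ≤ l) :
    P.real {ω | a n ω = i ∧ l ≤ pulls (fun m => a m ω) n i} ≤ 2 / ((n : ℝ) + 1) ^ 2 := by
  refine (measureReal_mono (h.late_pull_subset hμ hr hi hn hl0 hl hlr)
    (measure_ne_top _ _)).trans ?_
  refine (measureReal_biUnion_finset_le _ _).trans ?_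
  have hn1 : (1 : ℝ) ≤ (n : ℝ) + 1 := by linarith [n.cast_nonneg (α := ℝ)]
  calc ∑ s ∈ Finset.Icc 1 n,
        P.real (deviationSet μ a x 0 (-1) n s ∪ deviationSet μ a x i 1 n s)
      ≤ ∑ s ∈ Finset.Icc 1 n, 2 / ((n : ℝ) + 1) ^ 4 := by
        refine Finset.sum_le_sum fun s hs => ?_
        have hs0 : s ≠ 0 := by have := (Finset.mem_Icc.mp hs).1; omega
        have h1 := h.measureReal_deviationSet_le 0 (hμ_mem 0) (ε := -1) (by norm_num) n hs0
        have h2 := h.measureReal_deviationSet_le i (hμ_mem i) (ε := 1) (by norm_num) n hs0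
        calc _ ≤ _ := measureReal_union_le _ _
          _ ≤ 1 / ((n : ℝ) + 1) ^ 4 + 1 / ((n : ℝ) + 1) ^ 4 := add_le_add h1 h2
          _ = _ := by ring
    _ = n * (2 / ((n : ℝ) + 1) ^ 4) := by simp
    _ ≤ ((n : ℝ) + 1) ^ 2 * (2 / ((n : ℝ) + 1) ^ 4) := by
        gcongr
        nlinarith
    _ = 2 / ((n : ℝ) + 1) ^ 2 := by
        field_simp

/-- The expected number of pulls of a suboptimal arm under Fair-UCB. -/
lemma IsRun.integral_pulls_le [IsProbabilityMeasure P]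
    (h : IsRun P ℱ (fairUCB r α) μ a x) (hμ : StrictAnti μ)
    (hμ_mem : ∀ i, μ i ∈ Set.Icc (0 : ℝ) 1) (hr : ∀ i, 0 ≤ r i) {i : Fin k} (hi : i ≠ 0)
    {T : ℕ} (hT : 1 ≤ T) :
    ∫ ω, (pulls (fun m => a m ω) T i : ℝ) ∂P ≤
      max (8 * Real.log T / gap μ i ^ 2) (r i * T - α) + (1 + Real.pi ^ 2 / 3) := by
  set u := max (8 * Real.log T / gap μ i ^ 2) (r i * T - α) with hu
  have hgap := gap_pos hμ hi
  have hlogT : 0 ≤ Real.log T := Real.log_nonneg (by exact_mod_cast hT)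
  have hu0 : 0 ≤ u := le_max_of_le_left (by positivity)
  have hpi : 0 ≤ Real.pi ^ 2 / 3 := by positivity
  -- For `T = 1` the logarithm vanishes and `u` may be 0, but the late-pull bound needs `l ≠ 0` to
  -- exclude UCB1's initial pulls.
  rcases hT.eq_or_lt with rfl | hT2
  · calc ∫ ω, (pulls (fun m => a m ω) 1 i : ℝ) ∂P ≤ ∫ _, (1 : ℝ) ∂P := by
          refine integral_mono (h.integrable_pulls 1 i) (integrable_const _) fun ω => ?_
          exact (Nat.cast_le.mpr (pulls_le (fun m => a m ω) 1 i)).trans_eq Nat.cast_one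
      _ = 1 := by simp
      _ ≤ _ := by linarith
  have hu1 : 0 < u := by
    have : 0 < Real.log T := Real.log_pos (by exact_mod_cast hT2)
    exact lt_max_of_lt_left (by positivity)
  set l := ⌈u⌉₊
  have hl0 : l ≠ 0 := (Nat.ceil_pos.mpr hu1).ne'
  have hul : u ≤ l := Nat.le_ceil u
  have hE : ∀ n, MeasurableSet {ω | a n ω = i ∧ l ≤ pulls (fun m => a m ω) n i} := by
    intro n
    have h2 : MeasurableSet {ω | (l : ℝ) ≤ pulls (fun m => a m ω) n i} :=
      measurableSet_le measurable_const ((h.measurable_pulls n i).mono (ℱ.le n) le_rfl)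
    simp only [Nat.cast_le] at h2
    exact (ℱ.le n _ (h.measurableSet_arm_eq n i)).inter h2
  have hEint : ∀ n, Integrable (Set.indicator
      {ω | a n ω = i ∧ l ≤ pulls (fun m => a m ω) n i} (fun _ => (1 : ℝ))) P := fun n =>
    (integrable_const _).indicator (hE n)
  calc ∫ ω, (pulls (fun m => a m ω) T i : ℝ) ∂P
      ≤ ∫ ω, ((l : ℝ) + ∑ n ∈ Finset.range T, Set.indicator
          {ω | a n ω = i ∧ l ≤ pulls (fun m => a m ω) n i} (fun _ => (1 : ℝ)) ω) ∂P := by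
        refine integral_mono (h.integrable_pulls T i)
          ((integrable_const _).add (integrable_finsetSum _ fun n _ => hEint n)) fun ω => ?_
        simp only [Set.indicator_apply, Set.mem_ofPred_eq]
        exact_mod_cast pulls_le_add_sum (fun m => a m ω) T i l
    _ = l + ∑ n ∈ Finset.range T,
          P.real {ω | a n ω = i ∧ l ≤ pulls (fun m => a m ω) n i} := by
        rw [integral_add (integrable_const _) (integrable_finsetSum _ fun n _ => hEint n),
          integral_finsetSum _ fun n _ => hEint n]
        congr 1
        · simp
        · exact Finset.sum_congr rfl fun n _ => integral_indicator_one (hE n)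
    _ ≤ l + ∑ n ∈ Finset.range T, 2 / ((n : ℝ) + 1) ^ 2 := by
        gcongr with n hn
        exact h.measureReal_late_pull_le hμ hμ_mem hr hi (Finset.mem_range.mp hn) hl0
          ((le_max_left _ _).trans hul) ((le_max_right _ _).trans hul)
    _ ≤ (u + 1) + Real.pi ^ 2 / 3 :=
        add_le_add (Nat.ceil_lt_add_one hu0).le (sum_two_div_sq_le T)
    _ = _ := by ring

lemma IsRun.expectedRegret_le [IsProbabilityMeasure P]
    (h : IsRun P ℱ (fairUCB r α) μ a x) (hμ : StrictAnti μ)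
    (hμ_mem : ∀ i, μ i ∈ Set.Icc (0 : ℝ) 1) (hr : ∀ i, 0 ≤ r i) {T : ℕ} (hT : 1 ≤ T) :
    expectedRegret P μ a T ≤
      ∑ i ∈ costlyArms μ r α T, (r i * T - α) * gap μ i +
        ∑ i ∈ Finset.univ.filter (fun i => i ≠ 0 ∧ i ∉ costlyArms μ r α T),
          8 * Real.log T / gap μ i +
        (1 + Real.pi ^ 2 / 3) * ∑ i, gap μ i := by
  have hsplit : ∑ i ∈ costlyArms μ r α T, (r i * T - α) * gap μ i =
      ∑ i, if i ∈ costlyArms μ r α T then (r i * T - α) * gap μ i else 0 := by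
    rw [← Finset.sum_filter, Finset.filter_univ_mem]
  rw [hsplit, Finset.sum_filter, Finset.mul_sum, ← Finset.sum_add_distrib,
    ← Finset.sum_add_distrib]
  refine Finset.sum_le_sum fun i _ => ?_
  have hmem : i ∈ costlyArms μ r α T ↔
      i ≠ 0 ∧ 8 * Real.log T / gap μ i ^ 2 ≤ r i * T - α := by
    simp [costlyArms]
  by_cases hi : i = 0
  · subst hi
    simp [hmem, gap]
  have hg := gap_pos hμ hi
  have hN := mul_le_mul_of_nonneg_left (h.integral_pulls_le hμ hμ_mem hr hi hT) hg.le
  by_cases hc : 8 * Real.log T / gap μ i ^ 2 ≤ r i * T - α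
  · have hin : i ∈ costlyArms μ r α T := hmem.mpr ⟨hi, hc⟩
    rw [max_eq_right hc] at hN
    simp only [hin, not_true_eq_false, and_false, if_true, if_false]
    linarith
  · have hin : i ∉ costlyArms μ r α T := fun h => hc (hmem.mp h).2
    rw [max_eq_left (not_le.mp hc).le] at hN
    simp only [hin, hi, not_false_eq_true, ne_eq, and_self, if_true, if_false]
    have e : gap μ i * (8 * Real.log T / gap μ i ^ 2) = 8 * Real.log T / gap μ i := by
      field_simp
    linarith

lemma IsRun.expectedRegret_le_mul [IsProbabilityMeasure P] {alg : LearningRule k}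
    (h : IsRun P ℱ alg μ a x) (hμ : StrictAnti μ) (T : ℕ) :
    expectedRegret P μ a T ≤ (∑ i, gap μ i) * T := by
  rw [expectedRegret, Finset.sum_mul]
  refine Finset.sum_le_sum fun i _ => mul_le_mul_of_nonneg_left ?_ (gap_nonneg hμ i)
  calc ∫ ω, (pulls (fun m => a m ω) T i : ℝ) ∂P ≤ ∫ _, (T : ℝ) ∂P := by
        refine integral_mono (h.integrable_pulls T i) (integrable_const _) fun ω => ?_
        exact Nat.cast_le.mpr (pulls_le (fun m => a m ω) T i)
    _ = T := by simp

/-- Only the pathwise fairness guarantee enters, so the learning rule is arbitrary; arms outside `S`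
can be dropped because gaps are nonnegative. -/
lemma IsRun.le_expectedRegret [IsProbabilityMeasure P] {learn : LearningRule k}
    (h : IsRun P ℱ (fairLearn r α learn) μ a x) (hμ : StrictAnti μ)
    (hr : ∀ i, 0 ≤ r i ∧ r i < 1 / (k : ℝ)) (hα : 0 ≤ α) (T : ℕ) (S : Finset (Fin k)) :
    ∑ i ∈ S, (r i * T - α - 1) * gap μ i ≤ expectedRegret P μ a T := by
  have h0 : ∀ i, 0 ≤ ∫ ω, (pulls (fun m => a m ω) T i : ℝ) ∂P :=
    fun i => integral_nonneg fun ω => Nat.cast_nonneg _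
  calc ∑ i ∈ S, (r i * T - α - 1) * gap μ i
      ≤ ∑ i ∈ S, gap μ i * ∫ ω, (pulls (fun m => a m ω) T i : ℝ) ∂P := by
        refine Finset.sum_le_sum fun i _ => ?_
        rw [mul_comm]
        refine mul_le_mul_of_nonneg_left ?_ (gap_nonneg hμ i)
        calc r i * T - α - 1 = ∫ _, (r i * T - α - 1) ∂P := by simp
          _ ≤ _ := by
            refine integral_mono (integrable_const _) (h.integrable_pulls T i) fun ω => ?_
            have := quota_sub_pulls_le hr hα (fun n => h.arm_mem n ω) T i
            simp only
            linarith
    _ ≤ expectedRegret P μ a T :=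
        Finset.sum_le_sum_of_subset_of_nonneg (Finset.subset_univ S)
          fun i _ _ => mul_nonneg (gap_nonneg hμ i) (h0 i)

end Regret

end FairMAB

theorem theorem4 {k : ℕ} [NeZero k] (μ : Fin k → ℝ)
    (hμ_mem : ∀ i, μ i ∈ Set.Icc (0 : ℝ) 1) (hμ_anti : StrictAnti μ) :
    ∃ C : ℝ, ∀ (r : Fin k → ℝ) (α : ℝ), (∀ i, 0 ≤ r i ∧ r i < 1 / (k : ℝ)) → 0 ≤ α →
      ∀ {Ω : Type*} [mΩ : MeasurableSpace Ω] (P : Measure Ω) [IsProbabilityMeasure P]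
        (ℱ : Filtration ℕ mΩ) (a : ℕ → Ω → Fin k) (x : ℕ → Ω → ℝ),
        FairMAB.IsRun P ℱ (FairMAB.fairUCB r α) μ a x →
        ∀ T : ℕ, 1 ≤ T →
          (FairMAB.expectedRegret P μ a T ≤
            ∑ i ∈ FairMAB.costlyArms μ r α T, (r i * T - α) * FairMAB.gap μ i +
              ∑ i ∈ Finset.univ.filter (fun i => i ≠ 0 ∧ i ∉ FairMAB.costlyArms μ r α T),
                8 * Real.log T / FairMAB.gap μ i +
              (1 + Real.pi ^ 2 / 3) * ∑ i, FairMAB.gap μ i) ∧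
          (2 ≤ T → FairMAB.costlyArms μ r α T = ∅ →
            FairMAB.expectedRegret P μ a T ≤ C * Real.log T) ∧
          ((FairMAB.costlyArms μ r α T).Nonempty →
            ∑ i ∈ FairMAB.costlyArms μ r α T, (r i * T - α - 1) * FairMAB.gap μ i ≤
                FairMAB.expectedRegret P μ a T ∧
              FairMAB.expectedRegret P μ a T ≤ C * T) := by
  have hgap := FairMAB.gap_nonneg hμ_anti
  have hG : 0 ≤ ∑ i, FairMAB.gap μ i := Finset.sum_nonneg fun i _ => hgap i
  have hlog2 : 0 < Real.log 2 := Real.log_pos one_lt_two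
  set D := (1 + Real.pi ^ 2 / 3) * ∑ i, FairMAB.gap μ i with hD
  have hD0 : 0 ≤ D := by positivity
  -- The term at `i = 0` is `8 / 0 = 0`, so summing over all arms is harmless.
  have hI : 0 ≤ ∑ i, 8 / FairMAB.gap μ i :=
    Finset.sum_nonneg fun i _ => div_nonneg (by norm_num) (hgap i)
  -- The first two summands serve the logarithmic bound, `D` being absorbed through `ln T ≥ ln 2`;
  -- the last serves the linear bound.
  refine ⟨∑ i, 8 / FairMAB.gap μ i + D / Real.log 2 + ∑ i, FairMAB.gap μ i, ?_⟩
  intro r α hr hα Ω mΩ P _ ℱ a x hrun T hT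
  have hupper := hrun.expectedRegret_le hμ_anti hμ_mem (fun i => (hr i).1) hT
  refine ⟨hupper, fun hT2 hS => ?_, fun _ =>
    ⟨hrun.le_expectedRegret hμ_anti hr hα T _,
      (hrun.expectedRegret_le_mul hμ_anti T).trans ?_⟩⟩
  · have hlog : Real.log 2 ≤ Real.log T :=
      Real.log_le_log two_pos (by exact_mod_cast hT2)
    rw [hS, Finset.sum_empty, zero_add] at hupper
    have h1 : ∑ i ∈ Finset.univ.filter (fun i : Fin k => i ≠ 0 ∧ i ∉ (∅ : Finset (Fin k))),
        8 * Real.log T / FairMAB.gap μ i ≤ (∑ i, 8 / FairMAB.gap μ i) * Real.log T := by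
      rw [Finset.sum_mul]
      refine (Finset.sum_le_sum_of_subset_of_nonneg (Finset.filter_subset _ _) fun i _ _ =>
        div_nonneg (by linarith) (hgap i)).trans (le_of_eq ?_)
      exact Finset.sum_congr rfl fun i _ => by ring
    have h2 : D ≤ D / Real.log 2 * Real.log T := by
      rw [div_mul_eq_mul_div, le_div_iff₀ hlog2]
      exact mul_le_mul_of_nonneg_left hlog hD0
    have h3 : 0 ≤ (∑ i, FairMAB.gap μ i) * Real.log T := mul_nonneg hG (by linarith)
    rw [add_mul, add_mul]
    linarith
  · refine mul_le_mul_of_nonneg_right ?_ (Nat.cast_nonneg T)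
    have : 0 ≤ D / Real.log 2 := by positivity
    linarith
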